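/- Scalars are real or complex. For a Banach space $X$, $\varepsilon>0$ and $L\subset X^*$, let $s_\varepsilon(L)$ be the set of $x^*\in L$ such that $\operatorname{diam}(V\cap L)>\varepsilon$ (norm diameter) for every weak$^*$-neighbourhood $V$ of $x^*$. Put $s^0_\varepsilon(L)=L$, $s^{\xi+1}_\varepsilon(L)=s_\varepsilon(s^\xi_\varepsilon(L))$, and $s^\xi_\varepsilon(L)=\bigcap_{\zeta<\xi}s^\zeta_\varepsilon(L)$ for $\xi$ a limit ordinal. Let $Sz_\varepsilon(L)$ be the least $\xi$ with $s^\xi_\varepsilon(L)=\varnothing$ ($\infty$ if there is none), $Sz(L)=\sup_{\varepsilon>0}Sz_\varepsilon(L)$, $Sz(X)=Sz(B_{X^*})$, and $Sz(\Phi)=Sz(\Phi^*B_{Y^*})$ for an operator $\Phi:X\to Y$. For a compact Hausdorff space $K$, let $K^0=K$, let $K^{\xi+1}$ be the set of non-isolated points of $K^\xi$, and let $K^\xi=\bigcap_{\zeta<\xi}K^\zeta$ for $\xi$ a limit ordinal. Let $CB(K)$ be the least $\xi$ with $K^\xi=\varnothing$ ($\infty$ if there is none, and then $\xi<CB(K)$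 for every ordinal $\xi$). For closed $F\subset K$ let $C_F(K)=\{f\in C(K): f|_F=0\}$, and let $\varphi_\gamma:C_{K^\gamma}(K)\to C(K)$ be the inclusion. If $CB(K)$ is an ordinal, it is a successor (for $K\ne\varnothing$), and $C_0(K)=C_{K^{CB(K)-1}}(K)$; for $K=\varnothing$, $C_0(K)=C(K)=\{0\}$. Regard $\ell_1(K)$ as a subspace of $C(K)^*$, with $a\in\ell_1(K)$ acting by $f\mapsto\sum_{x\in K}a_xf(x)$ (it is all of $C(K)^*$ when $CB(K)$ is an ordinal). **Theorem.** For every ordinal $\xi$ the following three statements hold. $(A_\xi)$ For every compact Hausdorff space $K$ with $CB(K)\le\omega^\xi$, $Sz(C_0(K))\le Sz(C(K))\le\omega^\xi$. $(B_\xi)$ For every $\gamma<\omega^\xi$ and every compact Hausdorff space $K$ with $\gamma<CB(K)$, $Sz(\varphi_\gamma)\le\omega^\xi$. $(C_\xi)$ For every compact Hausdorff space $K$ with $\omega^\xi<CB(K)$ and every $\varepsilon\in(0,1)$, $$\varphi^*_{\omega^\xi}\bigl(s^{\omega^\xi}_{3\varepsilon}(B_{\ell_1(K)})\bigr)\subset(1-\varepsilon)\,\varphi^*_{\omega^\xi}B_{\ell_1(K)},$$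 and the same inclusion holds with $B_{C(K)^*}$ in place of $B_{\ell_1(K)}$. -/

import Mathlib

open scoped Pointwise Ordinal

universe u

noncomputable section

/-- The minimum ordinal `ξ` such that `S ξ = ∅`, and `⊤` (i.e. `∞`) if there is no such ordinal. -/
def firstEmpty {α : Type u} (S : Ordinal.{u} → Set α) : WithTop Ordinal.{u} :=
  sInf ((fun ξ : Ordinal.{u} => (ξ : WithTop Ordinal.{u})) '' {ξ | S ξ = ∅})

/-! ### Cantor-Bendixson derivatives -/

/-- The Cantor-Bendixson derivative `K^ξ` of the space `K`. -/
def cbDeriv (K : Type u) [TopologicalSpace K] (ξ : Ordinal.{u}) : Set K :=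
  CantorBendixson.iteratedDerivedSet (Set.univ : Set K) ξ

/-- The Cantor-Bendixson index `CB(K)`; it is `⊤` if `K` is not scattered. -/
def cbIndex (K : Type u) [TopologicalSpace K] : WithTop Ordinal.{u} :=
  firstEmpty (cbDeriv K)

/-- `K_∞ = K^{CB(K) - 1}`, the last non-empty derivative of a non-empty compact scattered `K`
(for such a space `CB(K)` is a successor ordinal).  Only used when `CB(K)` is an ordinal. -/
def cbLast (K : Type u) [TopologicalSpace K] : Set K :=
  cbDeriv K (Ordinal.pred ((cbIndex K).untopD 0))

/-! ### The Szlenk index -/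

section Szlenk

variable {𝕜 : Type} [RCLike 𝕜]
variable {X : Type u} [NormedAddCommGroup X] [NormedSpace 𝕜 X]

/-- `s_ε(L)`: the points of `L` all of whose weak-star neighbourhoods `V` satisfy
`diam (V ∩ L) > ε`, the diameter being taken in the norm of the dual space. -/
def szlenkStep (ε : ℝ) (L : Set (WeakDual 𝕜 X)) : Set (WeakDual 𝕜 X) :=
  {x | x ∈ L ∧ ∀ V ∈ nhds x,
    ENNReal.ofReal ε < Metric.ediam ((WeakDual.toStrongDual : WeakDual 𝕜 X → _) '' (V ∩ L))}

/-- The transfinite iterates `s_ε^ξ(L)`. -/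
def szlenkDeriv (ε : ℝ) (L : Set (WeakDual 𝕜 X)) (ξ : Ordinal.{u}) : Set (WeakDual 𝕜 X) :=
  Ordinal.limitRecOn ξ L (fun _ S => szlenkStep ε S) (fun ξ _ S => ⋂ (ζ) (h : ζ < ξ), S ζ h)

/-- `Sz(L) = sup_{ε > 0} Sz_ε(L)`, where `Sz_ε(L)` is the first `ξ` with `s_ε^ξ(L) = ∅`. -/
def szlenkSet (L : Set (WeakDual 𝕜 X)) : WithTop Ordinal.{u} :=
  ⨆ (ε : ℝ) (_ : 0 < ε), firstEmpty (szlenkDeriv ε L)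

variable (𝕜 X) in
/-- The closed unit ball `B_{X^*}` of the dual, as a subset of the dual with its weak-star
topology. -/
def dualBall : Set (WeakDual 𝕜 X) :=
  {x | ‖WeakDual.toStrongDual x‖ ≤ 1}

variable (𝕜 X) in
/-- The Szlenk index `Sz(X) = Sz(B_{X^*})`. -/
def szlenkSpace : WithTop Ordinal.{u} :=
  szlenkSet (dualBall 𝕜 X)

/-- The adjoint `Φ^* : Y^* → X^*` of an operator `Φ : X → Y`. -/
def adjointMap {Y : Type u} [NormedAddCommGroup Y] [NormedSpace 𝕜 Y] (Φ : X →L[𝕜] Y)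
    (y : WeakDual 𝕜 Y) : WeakDual 𝕜 X :=
  StrongDual.toWeakDual ((WeakDual.toStrongDual y).comp Φ)

/-- The Szlenk index `Sz(Φ) = Sz(Φ^* B_{Y^*})` of an operator `Φ : X → Y`. -/
def szlenkOp {Y : Type u} [NormedAddCommGroup Y] [NormedSpace 𝕜 Y] (Φ : X →L[𝕜] Y) :
    WithTop Ordinal.{u} :=
  szlenkSet (adjointMap Φ '' dualBall 𝕜 Y)

end Szlenk

/-! ### Subspaces and functionals on `C(K)` -/

section CK

variable (𝕜 : Type) [RCLike 𝕜]
variable {K : Type u} [TopologicalSpace K] [CompactSpace K]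

/-- `C_F(K)`: the functions in `C(K)` that vanish on `F`. -/
def vanishingOn (F : Set K) : Submodule 𝕜 C(K, 𝕜) where
  carrier := {f | ∀ x ∈ F, f x = 0}
  add_mem' {f g} hf hg x hx := by simp [hf x hx, hg x hx]
  zero_mem' x _ := by simp
  smul_mem' c f hf x hx := by simp [hf x hx]

variable (K) in
/-- `C_0(K) = C_{K_∞}(K)`. -/
abbrev czero : Submodule 𝕜 C(K, 𝕜) :=
  vanishingOn 𝕜 (cbLast K)

variable (K) in
/-- The inclusion `φ_γ : C_{K^γ}(K) → C(K)`. -/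
def inclDeriv (γ : Ordinal.{u}) : vanishingOn 𝕜 (cbDeriv K γ) →L[𝕜] C(K, 𝕜) :=
  (vanishingOn 𝕜 (cbDeriv K γ)).subtypeL

variable (K) in
/-- The closed unit ball of `ℓ_1(K)`, where `a ∈ ℓ_1(K)` is identified with the functional
`f ↦ ∑ x, a x * f x` on `C(K)`. -/
def ellOneBall : Set (WeakDual 𝕜 C(K, 𝕜)) :=
  {μ | ∃ a : lp (fun _ : K => 𝕜) 1, ‖a‖ ≤ 1 ∧
    ∀ f : C(K, 𝕜), HasSum (fun x => a x * f x) (μ f)}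

end CK

end

/-!
The theorem rests on one estimate.  Let `F ⊆ K` be closed and let `μ` be a functional on `C(K)`
with norm at most `r`.  If `μ` has norm more than `r - κ` on `C_F(K)`, this is witnessed by a
function `f'` whose support lies in a closed set `W` disjoint from `F`.  The inequality
`|ν f'| > r - κ` persists for all `ν` weak-star near `μ`, and since functions with disjoint supports
share the norm of a functional between them (`norm_apply_add_norm_apply_le`), each such `ν` of norm
at most `r` is within `κ` of a functional carried by `W`.  So the points of this slice are removed
as quickly as those of a ball of `C(W)^*`, and what remains of the ball after that many derivations
has norm at most `r - κ` on `C_F(K)` (`szlenkDeriv_weakBall_subset_vanishingBound`).  A variant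
measures only the norm on `C_F(K)` and lets the functionals be carried by `W ∪ F`
(`szlenkDeriv_weakBall_inter_vanishingBound_subset`).  Both compare derivations of different sets,
for which `szlenkDeriv_subset_of_rel` is the general tool.

With `F = K^(ω^ξ)` and `n ≥ 1` the variant passes from spaces with `K^(ω^ξ * n) = ∅` to spaces with
`K^(ω^ξ * (n + 1)) = ∅`, because `(W ∪ F)^(ω^ξ * n) = ∅` (`cbDeriv_union_eq_empty`); repeating it
about `1 / κ` times uses up the whole norm.  Hence a number `m` depending only on `ξ`, `n`, the
radius of the ball and the size of the derivation satisfies: `ω^ξ * m` derivations exhaust the ball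
of `C(K)^*` (`exists_nat_szlenkDeriv_weakBall_eq_empty`).  By compactness, `K^(ω^ξ) = ∅` with
`ξ ≠ 0` implies `K^(ω^ζ * n) = ∅` for some `ζ < ξ` and some `n`, so induction on `ξ`, starting
from finite spaces, shows that `ω^ξ` derivations exhaust the balls of `C(K)^*` when `K^(ω^ξ) = ∅`
(`szlenkDeriv_weakBall_eq_empty`), which is the bound in (A); passing to the subspace `C_0(K)` does
not raise the Szlenk index (`szlenkSpace_submodule_le`).

Given this, (C) is the first form of the estimate with `F = K^(ω^ξ)`, `r = 1` and `κ = ε`, followed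
by an extension of the restricted functional: by the Hahn-Banach theorem for `B_{C(K)^*}`, and by
dropping the mass on `F` for `B_{ℓ_1(K)}`.  For (B) the first form is applied with `F = K^γ` and
transferred to the dual of `C_F(K)`, where it lowers the radius of the ball by `κ`; since the closed
sets `W` satisfy `W^γ = ∅`, the uniform number `m` serves for all of them, and finitely many
repetitions suffice.
-/

noncomputable section

/-! ### The Szlenk derivation -/

section SzlenkDerivation

open Set Topology

theorem ordinal_sub_lt_of_lt_add {ζ η θ : Ordinal.{u}} (h : ζ < η + θ) (hθ : 0 < θ) :
    ζ - η < θ := by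
  rcases le_total η ζ with hle | hle
  · rw [← Ordinal.add_sub_cancel_of_le hle] at h
    exact lt_of_add_lt_add_left h
  · rwa [Ordinal.sub_eq_zero_iff_le.2 hle]

variable {𝕜 : Type} [RCLike 𝕜]
variable {X : Type u} [NormedAddCommGroup X] [NormedSpace 𝕜 X]
variable {Y : Type u} [NormedAddCommGroup Y] [NormedSpace 𝕜 Y]
variable {ε δ κ r : ℝ} {L M : Set (WeakDual 𝕜 X)}

theorem mem_szlenkStep_iff (hε : 0 ≤ ε) {x : WeakDual 𝕜 X} :
    x ∈ szlenkStep ε L ↔ x ∈ L ∧ ∀ V ∈ 𝓝 x, ∃ y ∈ V ∩ L, ∃ z ∈ V ∩ L,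
      ε < ‖WeakDual.toStrongDual y - WeakDual.toStrongDual z‖ := by
  have key (A : Set (WeakDual 𝕜 X)) :
      ENNReal.ofReal ε < Metric.ediam ((WeakDual.toStrongDual : WeakDual 𝕜 X → _) '' A) ↔
        ∃ y ∈ A, ∃ z ∈ A, ε < ‖WeakDual.toStrongDual y - WeakDual.toStrongDual z‖ := by
    simp only [Metric.ediam, lt_iSup_iff, exists_prop, exists_mem_image, edist_dist, dist_eq_norm,
      ENNReal.ofReal_lt_ofReal_iff_of_nonneg hε]
  simp only [szlenkStep, mem_ofPred_eq, key]

theorem szlenkStep_subset : szlenkStep ε L ⊆ L := fun _ hx => hx.1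

theorem szlenkStep_mono (h : L ⊆ M) : szlenkStep ε L ⊆ szlenkStep ε M := fun _ hx =>
  ⟨h hx.1, fun V hV => (hx.2 V hV).trans_le
    (Metric.ediam_mono (image_mono (inter_subset_inter_right V h)))⟩

theorem isClosed_szlenkStep (hL : IsClosed L) : IsClosed (szlenkStep ε L) := by
  rw [← isOpen_compl_iff, isOpen_iff_mem_nhds]
  intro x hx
  by_cases hxL : x ∈ L
  · have : ∃ V ∈ 𝓝 x, ¬ ENNReal.ofReal ε <
        Metric.ediam ((WeakDual.toStrongDual : WeakDual 𝕜 X → _) '' (V ∩ L)) := by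
      by_contra! h
      exact hx ⟨hxL, h⟩
    obtain ⟨V, hV, hVd⟩ := this
    filter_upwards [eventually_mem_nhds_iff.2 hV] with y hy hyL
    exact hVd (hyL.2 V hy)
  · filter_upwards [hL.isOpen_compl.mem_nhds hxL] with y hy hyL
    exact hy hyL.1

@[simp]
theorem szlenkDeriv_zero : szlenkDeriv ε L 0 = L := by
  simp [szlenkDeriv]

@[simp]
theorem szlenkDeriv_add_one (η : Ordinal.{u}) :
    szlenkDeriv ε L (η + 1) = szlenkStep ε (szlenkDeriv ε L η) := by
  simp [szlenkDeriv]

theorem szlenkDeriv_limit {η : Ordinal.{u}} (hη : Order.IsSuccLimit η) :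
    szlenkDeriv ε L η = ⋂ (ζ) (_ : ζ < η), szlenkDeriv ε L ζ := by
  rw [szlenkDeriv, Ordinal.limitRecOn_limit _ _ _ _ hη]
  rfl

theorem szlenkDeriv_antitone (ε : ℝ) (L : Set (WeakDual 𝕜 X)) : Antitone (szlenkDeriv ε L) := by
  intro η θ h
  induction θ using Ordinal.limitRecOn with
  | zero => rw [nonpos_iff_eq_zero.1 h]
  | add_one θ ih =>
    rcases h.lt_or_eq with h | rfl
    · rw [szlenkDeriv_add_one]
      exact szlenkStep_subset.trans (ih (Order.lt_add_one_iff.1 h))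
    · rfl
  | limit θ hθ ih =>
    rcases h.lt_or_eq with h | rfl
    · rw [szlenkDeriv_limit hθ]
      exact iInter₂_subset η h
    · rfl

theorem szlenkDeriv_subset (η : Ordinal.{u}) : szlenkDeriv ε L η ⊆ L := by
  simpa using szlenkDeriv_antitone ε L (zero_le (a := η))

theorem szlenkDeriv_mono (h : L ⊆ M) (η : Ordinal.{u}) :
    szlenkDeriv ε L η ⊆ szlenkDeriv ε M η := by
  induction η using Ordinal.limitRecOn with
  | zero => simpa
  | add_one η ih => simpa using szlenkStep_mono ih
  | limit η hη ih =>
    rw [szlenkDeriv_limit hη, szlenkDeriv_limit hη]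
    exact iInter₂_mono ih

theorem isClosed_szlenkDeriv (hL : IsClosed L) (η : Ordinal.{u}) :
    IsClosed (szlenkDeriv ε L η) := by
  induction η using Ordinal.limitRecOn with
  | zero => simpa
  | add_one η ih => simpa using isClosed_szlenkStep ih
  | limit η hη ih =>
    rw [szlenkDeriv_limit hη]
    exact isClosed_biInter ih

theorem szlenkDeriv_add (η θ : Ordinal.{u}) :
    szlenkDeriv ε L (η + θ) = szlenkDeriv ε (szlenkDeriv ε L η) θ := by
  induction θ using Ordinal.limitRecOn with
  | zero => simp
  | add_one θ ih => rw [← add_assoc, szlenkDeriv_add_one, szlenkDeriv_add_one, ih]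
  | limit θ hθ ih =>
    rw [szlenkDeriv_limit hθ, szlenkDeriv_limit (Ordinal.isSuccLimit_add η hθ)]
    refine Subset.antisymm (subset_iInter₂ fun ζ hζ => ?_) (subset_iInter₂ fun ζ hζ => ?_)
    · rw [← ih ζ hζ]
      exact iInter₂_subset (η + ζ) (by simpa using hζ)
    · have hlt : ζ - η < θ := ordinal_sub_lt_of_lt_add hζ hθ.bot_lt
      refine (iInter₂_subset (ζ - η) hlt).trans ?_
      rw [← ih _ hlt]
      exact szlenkDeriv_antitone ε L (Ordinal.le_add_sub ζ η)

/-- The derivation is local: inside a weak-star open set `V` the derived sets of `L` only depend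
on `L ∩ V`. -/
theorem szlenkDeriv_inter_subset {V : Set (WeakDual 𝕜 X)} (hV : IsOpen V) (η : Ordinal.{u}) :
    szlenkDeriv ε L η ∩ V ⊆ szlenkDeriv ε (L ∩ V) η := by
  induction η using Ordinal.limitRecOn with
  | zero => simp
  | add_one η ih =>
    rw [szlenkDeriv_add_one, szlenkDeriv_add_one]
    rintro x ⟨hx, hxV⟩
    refine ⟨ih ⟨hx.1, hxV⟩, fun U hU => ?_⟩
    refine (hx.2 (U ∩ V) (Filter.inter_mem hU (hV.mem_nhds hxV))).trans_le
      (Metric.ediam_mono (image_mono ?_))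
    rintro y ⟨⟨hyU, hyV⟩, hy⟩
    exact ⟨hyU, ih ⟨hy, hyV⟩⟩
  | limit η hη ih =>
    rw [szlenkDeriv_limit hη, szlenkDeriv_limit hη]
    exact subset_iInter₂ fun ζ hζ =>
      (inter_subset_inter_left V (iInter₂_subset ζ hζ)).trans (ih ζ hζ)

/-- Comparison of two derivations along a weak-star closed relation `ρ` under which every point of
`L` is related to a point of the compact set `M`.  Two points of `L` close to a common point `x`
are compared with two possibly different companions `y₁`, `y₂` of `x`, which is why the radius
`δ` is doubled. -/
theorem szlenkDeriv_subset_of_rel {M : Set (WeakDual 𝕜 Y)} (hδ : 0 ≤ δ) (hκ : 0 ≤ κ)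
    (hM : IsCompact M) (ρ : WeakDual 𝕜 X → WeakDual 𝕜 Y → Prop)
    (hρ : IsClosed {p : WeakDual 𝕜 X × WeakDual 𝕜 Y | ρ p.1 p.2})
    (hex : ∀ x ∈ L, ∃ y ∈ M, ρ x y)
    (hd : ∀ x ∈ L, ∀ x' ∈ L, ∀ x'' ∈ L, ∀ y₁ y₂ y' y'', ρ x y₁ → ρ x y₂ → ρ x' y' → ρ x'' y'' →
      ‖WeakDual.toStrongDual x' - WeakDual.toStrongDual x''‖ ≤
        ‖WeakDual.toStrongDual y₁ - WeakDual.toStrongDual y'‖ +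
        ‖WeakDual.toStrongDual y₂ - WeakDual.toStrongDual y''‖ + κ)
    (η : Ordinal.{u}) :
    szlenkDeriv (2 * δ + κ) L η ⊆ {x | ∃ y ∈ szlenkDeriv δ M η, ρ x y} := by
  have hcl (ζ : Ordinal.{u}) : IsClosed (szlenkDeriv δ M ζ) := isClosed_szlenkDeriv hM.isClosed ζ
  have hfib (x : WeakDual 𝕜 X) : IsClosed {y | ρ x y} := hρ.preimage (Continuous.prodMk_right x)
  have hcpt (x : WeakDual 𝕜 X) (ζ : Ordinal.{u}) :
      IsCompact (szlenkDeriv δ M ζ ∩ {y | ρ x y}) :=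
    hM.of_isClosed_subset ((hcl ζ).inter (hfib x))
      (inter_subset_left.trans (szlenkDeriv_subset ζ))
  induction η using Ordinal.limitRecOn with
  | zero => simpa [subset_def] using hex
  | add_one η ih =>
    rw [szlenkDeriv_add_one, szlenkDeriv_add_one]
    intro x hx
    rw [mem_szlenkStep_iff (by positivity)] at hx
    by_contra hno
    have hno' : ∀ y ∈ szlenkDeriv δ M η ∩ {y | ρ x y}, ∃ V : Set (WeakDual 𝕜 Y), IsOpen V ∧
        y ∈ V ∧ ∀ z ∈ V ∩ szlenkDeriv δ M η, ∀ z' ∈ V ∩ szlenkDeriv δ M η,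
          ‖WeakDual.toStrongDual z - WeakDual.toStrongDual z'‖ ≤ δ := by
      rintro y ⟨hyM, hy⟩
      have h1 : y ∉ szlenkStep δ (szlenkDeriv δ M η) := fun h => hno ⟨y, h, hy⟩
      rw [mem_szlenkStep_iff hδ] at h1
      push Not at h1
      obtain ⟨V, hV, h2⟩ := h1 hyM
      obtain ⟨U, hUV, hUo, hyU⟩ := mem_nhds_iff.1 hV
      exact ⟨U, hUo, hyU, fun z hz z' hz' =>
        h2 z ⟨hUV hz.1, hz.2⟩ z' ⟨hUV hz'.1, hz'.2⟩⟩
    choose! V hVo hyV hVd using hno'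
    -- The companions of points near `x` lie in the union of these small open sets.
    set O : Set (WeakDual 𝕜 Y) := ⋃ y ∈ szlenkDeriv δ M η ∩ {y | ρ x y}, V y with hO
    have hOo : IsOpen O := isOpen_biUnion hVo
    have hC : IsCompact (szlenkDeriv δ M η \ O) :=
      hM.of_isClosed_subset ((hcl η).sdiff hOo) (sdiff_subset.trans (szlenkDeriv_subset η))
    obtain ⟨U, U', hUo, -, hxU, hCU', hUU'⟩ := generalized_tube_lemma (s := {x})
      isCompact_singleton hC hρ.isOpen_compl (by
        rintro ⟨x', y⟩ ⟨rfl, hyM, hyO⟩ hy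
        exact hyO (mem_biUnion (⟨hyM, hy⟩ : y ∈ szlenkDeriv δ M η ∩ {y | ρ x' y})
          (hyV y ⟨hyM, hy⟩)))
    have hcover : ∀ x' ∈ U ∩ szlenkDeriv (2 * δ + κ) L η, ∃ y₁ y', ρ x y₁ ∧ ρ x' y' ∧
        ‖WeakDual.toStrongDual y₁ - WeakDual.toStrongDual y'‖ ≤ δ := by
      rintro x' ⟨hxU', hx'⟩
      obtain ⟨y', hy'M, hy'⟩ := ih hx'
      have hy'O : y' ∈ O := by
        by_contra h
        exact hUU' (mk_mem_prod hxU' (hCU' ⟨hy'M, h⟩)) hy'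
      rw [hO] at hy'O
      obtain ⟨y₁, hy₁, hy'V⟩ := mem_iUnion₂.1 hy'O
      exact ⟨y₁, y', hy₁.2, hy', hVd y₁ hy₁ y₁ ⟨hyV y₁ hy₁, hy₁.1⟩ y' ⟨hy'V, hy'M⟩⟩
    obtain ⟨x', hx', x'', hx'', hlt⟩ := hx.2 U (hUo.mem_nhds (hxU rfl))
    obtain ⟨y₁, y', h₁, h', hy'⟩ := hcover x' hx'
    obtain ⟨y₂, y'', h₂, h'', hy''⟩ := hcover x'' hx''
    have := hd x (szlenkDeriv_subset _ hx.1) x' (szlenkDeriv_subset _ hx'.2) x''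
      (szlenkDeriv_subset _ hx''.2) y₁ y₂ y' y'' h₁ h₂ h' h''
    linarith
  | limit η hη ih =>
    intro x hx
    rw [szlenkDeriv_limit hη] at hx
    have : Nonempty (Iio η) := ⟨⟨0, hη.bot_lt⟩⟩
    obtain ⟨y, hy⟩ := IsCompact.nonempty_iInter_of_directed_nonempty_isCompact_isClosed
      (fun ζ : Iio η => szlenkDeriv δ M ζ ∩ {y | ρ x y})
      (Antitone.directed_ge fun a b hab =>
        inter_subset_inter_left _ (szlenkDeriv_antitone δ M hab))
      (fun ζ => by
        obtain ⟨y, hy, hxy⟩ := ih ζ ζ.2 (mem_iInter₂.1 hx ζ ζ.2)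
        exact ⟨y, hy, hxy⟩)
      (fun ζ => hcpt x ζ) (fun ζ => (hcl ζ).inter (hfib x))
    rw [mem_iInter] at hy
    refine ⟨y, ?_, (hy ⟨0, hη.bot_lt⟩).2⟩
    rw [szlenkDeriv_limit hη]
    exact mem_iInter₂.2 fun ζ hζ => (hy ⟨ζ, hζ⟩).1

/-- If every application of `θ` derivations lowers the size of the members of a set, measured by
a function with sublevel sets `S r`, by `κ`, then `θ * N` derivations lower it by `N * κ`. -/
theorem szlenkDeriv_mul_natCast_subset {θ : Ordinal.{u}} (S : ℝ → Set (WeakDual 𝕜 X))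
    (hS : ∀ r, szlenkDeriv ε (S r) θ ⊆ S (r - κ)) (r : ℝ) (N : ℕ) :
    szlenkDeriv ε (S r) (θ * N) ⊆ S (r - N * κ) := by
  induction N with
  | zero => simp
  | succ N ih =>
    rw [Nat.cast_add_one, mul_add_one, szlenkDeriv_add]
    refine ((szlenkDeriv_mono ih θ).trans (hS _)).trans_eq ?_
    congr 1
    push_cast
    ring

end SzlenkDerivation

/-! ### First vanishing stages -/

section FirstEmpty

theorem firstEmpty_mono {α β : Type u} {S : Ordinal.{u} → Set α} {T : Ordinal.{u} → Set β}
    (h : ∀ ξ, T ξ = ∅ → S ξ = ∅) : firstEmpty S ≤ firstEmpty T :=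
  sInf_le_sInf (Set.image_mono h)

theorem firstEmpty_le {α : Type u} {S : Ordinal.{u} → Set α} {ξ : Ordinal.{u}} (h : S ξ = ∅) :
    firstEmpty S ≤ ξ :=
  sInf_le ⟨ξ, h, rfl⟩

theorem eq_empty_of_firstEmpty_le {α : Type u} {S : Ordinal.{u} → Set α} (hS : Antitone S)
    {ξ : Ordinal.{u}} (h : firstEmpty S ≤ ξ) : S ξ = ∅ := by
  have hne : ((fun ξ : Ordinal.{u} => (ξ : WithTop Ordinal.{u})) '' {ξ | S ξ = ∅}).Nonempty := by
    by_contra hne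
    rw [Set.not_nonempty_iff_eq_empty] at hne
    rw [firstEmpty, hne, sInf_empty] at h
    exact absurd (top_le_iff.1 h) (WithTop.coe_ne_top)
  obtain ⟨ζ, hζ, hζe⟩ := csInf_mem hne
  have : ζ ≤ ξ := by
    rw [← WithTop.coe_le_coe]
    exact hζe.le.trans h
  exact Set.subset_eq_empty (hS this) hζ

end FirstEmpty

/-! ### Cantor-Bendixson derivatives of subspaces -/

section CantorBendixsonSubspace

open Set Topology Filter

variable {K : Type u} [TopologicalSpace K]

@[simp]
theorem cbDeriv_zero : cbDeriv K 0 = univ := CantorBendixson.iteratedDerivedSet_zero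

theorem cbDeriv_add_one (η : Ordinal.{u}) :
    cbDeriv K (η + 1) = derivedSet (cbDeriv K η) ∩ cbDeriv K η :=
  CantorBendixson.iteratedDerivedSet_succ

theorem cbDeriv_limit {η : Ordinal.{u}} (hη : Order.IsSuccLimit η) :
    cbDeriv K η = ⋂ ζ : Iio η, cbDeriv K ζ :=
  CantorBendixson.iteratedDerivedSet_limit hη

theorem cbDeriv_antitone : Antitone (cbDeriv K) :=
  CantorBendixson.iteratedDerivedSet_antitone _

theorem isClosed_cbDeriv (η : Ordinal.{u}) : IsClosed (cbDeriv K η) :=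
  CantorBendixson.isClosed_iteratedDerivedSet isClosed_univ η

/-- If, inside an open set `U`, the subspace `S` is contained in `K^α`, then inside `U` its
derivatives `S^β` are contained in `K^(α + β)`. -/
theorem coe_mem_cbDeriv_add {S U : Set K} (hU : IsOpen U) {α : Ordinal.{u}}
    (h : S ∩ U ⊆ cbDeriv K α) (β : Ordinal.{u}) {x : S} (hx : x ∈ cbDeriv S β)
    (hxU : (x : K) ∈ U) : (x : K) ∈ cbDeriv K (α + β) := by
  induction β using Ordinal.limitRecOn generalizing x with
  | zero => simpa using h ⟨x.2, hxU⟩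
  | add_one β ih =>
    rw [cbDeriv_add_one] at hx
    rw [← add_assoc, cbDeriv_add_one]
    refine ⟨?_, ih hx.2 hxU⟩
    rw [mem_derivedSet, accPt_iff_nhds]
    intro V hV
    obtain ⟨y, ⟨hyV, hy⟩, hyx⟩ := accPt_iff_nhds.1 (mem_derivedSet.1 hx.1)
      ((↑) ⁻¹' (V ∩ U)) (continuous_subtype_val.continuousAt.preimage_mem_nhds
        (inter_mem hV (hU.mem_nhds hxU)))
    exact ⟨y, ⟨hyV.1, ih hy hyV.2⟩, fun h => hyx (Subtype.ext h)⟩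
  | limit β hβ ih =>
    rw [cbDeriv_limit (Ordinal.isSuccLimit_add α hβ), mem_iInter]
    rw [cbDeriv_limit hβ, mem_iInter] at hx
    rintro ⟨ζ, hζ⟩
    have hlt : ζ - α < β := ordinal_sub_lt_of_lt_add hζ hβ.bot_lt
    exact cbDeriv_antitone (Ordinal.le_add_sub ζ α) (ih _ hlt (hx ⟨_, hlt⟩) hxU)

theorem coe_mem_cbDeriv {S : Set K} (β : Ordinal.{u}) {x : S} (hx : x ∈ cbDeriv S β) :
    (x : K) ∈ cbDeriv K β := by
  simpa using coe_mem_cbDeriv_add (α := 0) isOpen_univ (by simp) β hx (mem_univ _)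

theorem cbDeriv_eq_empty_of_disjoint {W : Set K} {γ : Ordinal.{u}}
    (h : Disjoint W (cbDeriv K γ)) : cbDeriv W γ = ∅ :=
  eq_empty_of_forall_notMem fun x hx => h.notMem_of_mem_left x.2 (coe_mem_cbDeriv γ hx)

/-- Adjoining to `K^θ` a closed set disjoint from it costs no derivatives beyond the first `θ`,
in which that set disappears. -/
theorem cbDeriv_union_eq_empty {W : Set K} {θ η : Ordinal.{u}} (hW : IsClosed W)
    (hWd : Disjoint W (cbDeriv K θ)) (hθη : θ ≤ η) (h : cbDeriv K (θ + η) = ∅) :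
    cbDeriv (W ∪ cbDeriv K θ : Set K) η = ∅ := by
  refine eq_empty_of_forall_notMem fun x hx => ?_
  have hxθ : (x : K) ∈ cbDeriv K θ := coe_mem_cbDeriv θ (cbDeriv_antitone hθη hx)
  have hxW : (x : K) ∈ Wᶜ := hWd.notMem_of_mem_right hxθ
  have := coe_mem_cbDeriv_add (α := θ) hW.isOpen_compl
    (by rintro y ⟨hy | hy, hyW⟩; exacts [absurd hy hyW, hy]) η hx hxW
  rwa [h] at this

theorem exists_cbDeriv_eq_empty_of_limit [CompactSpace K] {η : Ordinal.{u}}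
    (hη : Order.IsSuccLimit η) (h : cbDeriv K η = ∅) : ∃ ζ < η, cbDeriv K ζ = ∅ := by
  by_contra! hne
  have : Nonempty (Iio η) := ⟨⟨0, hη.bot_lt⟩⟩
  have := IsCompact.nonempty_iInter_of_directed_nonempty_isCompact_isClosed
    (fun ζ : Iio η => cbDeriv K ζ) (Antitone.directed_ge fun a b hab => cbDeriv_antitone hab)
    (fun ζ => hne ζ ζ.2) (fun ζ => (isClosed_cbDeriv _).isCompact)
    (fun ζ => isClosed_cbDeriv _)
  rw [← cbDeriv_limit hη, h] at this
  exact not_nonempty_empty this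

theorem finite_of_cbDeriv_one_eq_empty [CompactSpace K] (h : cbDeriv K 1 = ∅) : Finite K := by
  have : DiscreteTopology K := by
    rw [discreteTopology_iff_nhds_ne]
    intro x
    by_contra hx
    have : x ∈ cbDeriv K (0 + 1) := by
      rw [cbDeriv_add_one]
      simpa [AccPt, neBot_iff] using hx
    rw [zero_add, h] at this
    exact this
  exact finite_of_compact_of_discrete

end CantorBendixsonSubspace

/-! ### Functionals on `C(K)` -/

section Functionals

open Set Topology

variable {𝕜 : Type} [RCLike 𝕜]

variable (𝕜) in
/-- The closed ball of radius `R` of the dual of `X`, with the weak-star topology. -/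
def weakBall (X : Type u) [NormedAddCommGroup X] [NormedSpace 𝕜 X] (R : ℝ) :
    Set (WeakDual 𝕜 X) :=
  {x | ‖WeakDual.toStrongDual x‖ ≤ R}

theorem isCompact_weakBall {X : Type u} [NormedAddCommGroup X] [NormedSpace 𝕜 X] (R : ℝ) :
    IsCompact (weakBall 𝕜 X R) := by
  have := WeakDual.isCompact_closedBall (𝕜 := 𝕜) (0 : StrongDual 𝕜 X) R
  convert this using 1
  ext x
  simp [weakBall]

variable {K : Type u} [TopologicalSpace K] [CompactSpace K]

/-- The functionals on `C(K)` whose restriction to the subspace `C_F(K)` of functions vanishing on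
`F` has norm at most `r`.  For `r < 0` there are none. -/
def vanishingBound (F : Set K) (r : ℝ) : Set (WeakDual 𝕜 C(K, 𝕜)) :=
  {μ | ∀ f : C(K, 𝕜), (∀ x ∈ F, f x = 0) → ‖f‖ ≤ 1 → ‖μ f‖ ≤ r}

theorem norm_apply_le_of_mem_vanishingBound {F : Set K} {r : ℝ} {μ : WeakDual 𝕜 C(K, 𝕜)}
    (hμ : μ ∈ vanishingBound F r) {f : C(K, 𝕜)} (hf : ∀ x ∈ F, f x = 0) :
    ‖μ f‖ ≤ r * ‖f‖ := by
  rcases eq_or_ne f 0 with rfl | h0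
  · simp
  have hpos : 0 < ‖f‖ := norm_pos_iff.2 h0
  have := hμ (((‖f‖⁻¹ : ℝ) : 𝕜) • f) (fun x hx => by simp [hf x hx])
    (by rw [norm_smul]; simp [hpos.ne'])
  rw [map_smul, norm_smul] at this
  simp only [RCLike.norm_ofReal, abs_inv, abs_norm] at this
  rwa [inv_mul_le_iff₀ hpos, mul_comm] at this

theorem vanishingBound_empty {r : ℝ} (hr : 0 ≤ r) :
    vanishingBound (∅ : Set K) r = weakBall 𝕜 C(K, 𝕜) r := by
  ext μ
  constructor
  · intro h
    exact ContinuousLinearMap.opNorm_le_bound _ hr fun f =>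
      norm_apply_le_of_mem_vanishingBound h (by simp)
  · intro h f _ hf
    have h' : ‖WeakDual.toStrongDual μ‖ ≤ r := h
    calc ‖μ f‖ ≤ ‖WeakDual.toStrongDual μ‖ * ‖f‖ := (WeakDual.toStrongDual μ).le_opNorm f
      _ ≤ r * 1 := by gcongr
      _ = r := mul_one r

/-- Functions with disjoint supports, or more generally with `|u| + |v| ≤ 1`, share the norm of
a functional between them. -/
theorem norm_apply_add_norm_apply_le {G : Set K} {r : ℝ} {μ : WeakDual 𝕜 C(K, 𝕜)}
    (hμ : μ ∈ vanishingBound G r) {u v : C(K, 𝕜)} (hu : ∀ x ∈ G, u x = 0)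
    (hv : ∀ x ∈ G, v x = 0) (huv : ∀ x, ‖u x‖ + ‖v x‖ ≤ 1) : ‖μ u‖ + ‖μ v‖ ≤ r := by
  obtain ⟨a, ha, hau⟩ := RCLike.exists_norm_eq_mul_self (μ u)
  obtain ⟨b, hb, hbv⟩ := RCLike.exists_norm_eq_mul_self (μ v)
  have h := hμ (a • u + b • v) (fun x hx => by simp [hu x hx, hv x hx]) (by
    rw [ContinuousMap.norm_le _ zero_le_one]
    intro x
    calc ‖(a • u + b • v) x‖ ≤ ‖a • u x‖ + ‖b • v x‖ := norm_add_le _ _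
      _ ≤ 1 := by simpa [norm_smul, ha, hb] using huv x)
  rw [map_add, map_smul, map_smul, smul_eq_mul, smul_eq_mul, ← hau, ← hbv, ← RCLike.ofReal_add,
    RCLike.norm_ofReal, abs_of_nonneg (by positivity)] at h
  exact h

/-- A function `f` vanishing on `F` is uniformly approximated by functions `f'` supported away
from `F`, so `f'` can replace `f` as a witness for the norm of `μ` on `C_F(K)`; here `g` is a cutoff
function dominating `|f'|` and supported in a closed set `W` disjoint from `F`. -/
theorem exists_cutoff {F : Set K} {r : ℝ} (μ : WeakDual 𝕜 C(K, 𝕜)) {f : C(K, 𝕜)}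
    (hf : ∀ x ∈ F, f x = 0) (hf1 : ‖f‖ ≤ 1) (hr : r < ‖μ f‖) :
    ∃ (f' : C(K, 𝕜)) (g : C(K, ℝ)) (W : Set K), IsClosed W ∧ Disjoint W F ∧ r < ‖μ f'‖ ∧
      (∀ x, ‖f' x‖ ≤ g x) ∧ (∀ x, g x ≤ 1) ∧ ∀ x ∉ W, g x = 0 := by
  set C : ℝ := ‖WeakDual.toStrongDual μ‖ with hC
  have hC0 : 0 ≤ C := norm_nonneg _
  obtain ⟨t, ht, htC⟩ : ∃ t > 0, C * (3 * t) < ‖μ f‖ - r := by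
    refine ⟨(‖μ f‖ - r) / (3 * (C + 1)), by have := sub_pos.2 hr; positivity, ?_⟩
    have h1 : C * (3 * ((‖μ f‖ - r) / (3 * (C + 1)))) = (C / (C + 1)) * (‖μ f‖ - r) := by
      field_simp
    rw [h1]
    exact mul_lt_of_lt_one_left (sub_pos.2 hr) ((div_lt_one (by positivity)).2 (by linarith))
  let cut (c : ℝ) : C(K, ℝ) := ⟨fun x => min 1 (max 0 (‖f x‖ / t - c)), by fun_prop⟩
  have cut_nonneg (c : ℝ) (x : K) : 0 ≤ cut c x := le_min zero_le_one (le_max_left _ _)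
  have cut_le_one (c : ℝ) (x : K) : cut c x ≤ 1 := min_le_left _ _
  have cut_eq_one {c : ℝ} {x : K} (h : c + 1 ≤ ‖f x‖ / t) : cut c x = 1 :=
    min_eq_left (le_max_of_le_right (by linarith))
  have cut_eq_zero {c : ℝ} {x : K} (h : ‖f x‖ / t ≤ c) : cut c x = 0 := by
    have : max 0 (‖f x‖ / t - c) = 0 := max_eq_left (by linarith)
    simp [cut, this]
  let f' : C(K, 𝕜) := ⟨fun x => (cut 2 x : 𝕜) * f x, by fun_prop⟩
  have hf'x (x : K) : f' x = (cut 2 x : 𝕜) * f x := rfl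
  have hfx (x : K) : ‖f x‖ ≤ 1 := (f.norm_coe_le_norm x).trans hf1
  have hg (x : K) : (cut 1 x : 𝕜) * f' x = f' x := by
    rcases le_total (‖f x‖ / t) 2 with h | h
    · simp [hf'x, cut_eq_zero h]
    · rw [cut_eq_one (c := 1) (by linarith)]
      simp
  refine ⟨f', cut 1, {x | 1 ≤ ‖f x‖ / t}, isClosed_le continuous_const (by fun_prop), ?_, ?_,
    fun x => ?_, cut_le_one 1, fun x hx => cut_eq_zero (not_le.1 hx).le⟩
  · rw [Set.disjoint_left]
    intro x hx hxF
    have h1 : 1 ≤ ‖f x‖ / t := hx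
    simp [hf x hxF] at h1
    linarith
  · have hdist : ‖f - f'‖ ≤ 3 * t := by
      rw [ContinuousMap.norm_le _ (by positivity)]
      intro x
      have h1 : (f - f') x = ((1 - cut 2 x : ℝ) : 𝕜) * f x := by
        simp [hf'x, sub_mul]
      rw [h1, norm_mul, RCLike.norm_ofReal, abs_of_nonneg (by linarith [cut_le_one 2 x])]
      rcases le_total (‖f x‖ / t) 3 with h | h
      · rw [div_le_iff₀ ht] at h
        nlinarith [cut_nonneg 2 x, norm_nonneg (f x)]
      · rw [cut_eq_one (c := 2) (by linarith)]
        simp [ht.le]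
    have h2 : ‖μ f - μ f'‖ ≤ C * (3 * t) := by
      rw [← map_sub]
      exact ((WeakDual.toStrongDual μ).le_opNorm _).trans (by gcongr)
    have := norm_sub_norm_le (μ f) (μ f')
    linarith
  · rw [← hg x, norm_mul, RCLike.norm_ofReal, abs_of_nonneg (cut_nonneg 1 x)]
    refine mul_le_of_le_one_right (cut_nonneg 1 x) ?_
    rw [hf'x, norm_mul, RCLike.norm_ofReal, abs_of_nonneg (cut_nonneg 2 x)]
    exact mul_le_one₀ (cut_le_one 2 x) (norm_nonneg _) (hfx x)

variable [T2Space K]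

theorem exists_extension_of_isClosed {H : Set K} (hH : IsClosed H) [CompactSpace H]
    (φ : C(H, 𝕜)) : ∃ f : C(K, 𝕜), ‖f‖ = ‖φ‖ ∧ f.restrict H = φ := by
  obtain ⟨g, hg, hgr⟩ := BoundedContinuousFunction.exists_norm_eq_domRestrict_eq hH 𝕜
    (BoundedContinuousFunction.mkOfCompact φ)
  refine ⟨g.toContinuousMap, ?_, ?_⟩
  · rw [← BoundedContinuousFunction.norm_mkOfCompact, ← BoundedContinuousFunction.norm_mkOfCompact,
      ← hg]
    rfl
  · ext x
    exact congrArg (fun h => h x) hgr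

/-- A functional on `C(K)` that is `κ`-small on the functions vanishing on the closed set `H` is
`κ`-close to one carried by `H`: by Hahn-Banach, subtract a functional of norm at most `κ` with
the same restriction to `C_H(K)`; the difference factors through `C(H)` by Tietze's theorem. -/
theorem exists_functional_on_closed {H : Set K} (hH : IsClosed H) [CompactSpace H] {κ R : ℝ}
    (hκ : 0 ≤ κ) {μ : WeakDual 𝕜 C(K, 𝕜)} (hR : μ ∈ weakBall 𝕜 C(K, 𝕜) R)
    (hμ : ∀ h : C(K, 𝕜), (∀ x ∈ H, h x = 0) → ‖μ h‖ ≤ κ * ‖h‖) :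
    ∃ l ∈ weakBall 𝕜 C(H, 𝕜) (R + κ), ∀ h : C(K, 𝕜), ‖μ h - l (h.restrict H)‖ ≤ κ * ‖h‖ := by
  let m : StrongDual 𝕜 C(K, 𝕜) := WeakDual.toStrongDual μ
  obtain ⟨s, hs, hsn⟩ := exists_extension_norm_eq (vanishingOn 𝕜 H)
    (m.comp (vanishingOn 𝕜 H).subtypeL)
  have hsκ : ‖s‖ ≤ κ := by
    rw [hsn]
    exact ContinuousLinearMap.opNorm_le_bound _ hκ fun h => hμ h h.2
  have hker (h : C(K, 𝕜)) (hh : ∀ x ∈ H, h x = 0) : (m - s) h = 0 := by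
    have := hs ⟨h, hh⟩
    simp only [ContinuousLinearMap.coe_comp, Function.comp_apply, Submodule.subtypeL_apply] at this
    simp [this]
  have hwd {h h' : C(K, 𝕜)} (hh : h.restrict H = h'.restrict H) : (m - s) h = (m - s) h' := by
    rw [← sub_eq_zero, ← map_sub]
    refine hker _ fun x hx => ?_
    have := congrArg (fun f => f ⟨x, hx⟩) hh
    simpa [sub_eq_zero] using this
  choose e he_norm he using fun φ : C(H, 𝕜) => exists_extension_of_isClosed (𝕜 := 𝕜) hH φ
  have hms : ‖m - s‖ ≤ R + κ := (norm_sub_le _ _).trans (add_le_add hR hsκ)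
  have hbd (φ : C(H, 𝕜)) : ‖(m - s) (e φ)‖ ≤ ‖m - s‖ * ‖φ‖ := by
    rw [← he_norm φ]
    exact (m - s).le_opNorm _
  let l : StrongDual 𝕜 C(H, 𝕜) := LinearMap.mkContinuous
    { toFun := fun φ => (m - s) (e φ)
      map_add' := fun φ ψ => by
        rw [← map_add]
        refine hwd ?_
        rw [he]
        ext x
        have h1 := congrArg (fun f => f x) (he φ)
        have h2 := congrArg (fun f => f x) (he ψ)
        simp only [ContinuousMap.restrict_apply] at h1 h2
        simp [h1, h2]
      map_smul' := fun c φ => by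
        rw [RingHom.id_apply, ← map_smul]
        refine hwd ?_
        rw [he]
        ext x
        have h1 := congrArg (fun f => f x) (he φ)
        simp only [ContinuousMap.restrict_apply] at h1
        simp [h1] } ‖m - s‖ hbd
  refine ⟨StrongDual.toWeakDual l, ?_, fun h => ?_⟩
  · exact (l.opNorm_le_bound (norm_nonneg _) hbd).trans hms
  · have h1 : l (h.restrict H) = (m - s) h := hwd (he _)
    have h2 : μ h - l (h.restrict H) = s h := by
      rw [h1]
      change m h - (m h - s h) = s h
      ring
    change ‖μ h - l (h.restrict H)‖ ≤ _
    rw [h2]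
    exact (s.le_opNorm h).trans (by gcongr)

end Functionals

/-! ### Slices of balls of `C(K)^*` -/

section Slices

open Set Topology

variable {𝕜 : Type} [RCLike 𝕜] {K : Type u} [TopologicalSpace K] [CompactSpace K]

/-- The functional `h ↦ μ (a * h)`. -/
def mulDual (a : C(K, 𝕜)) (μ : WeakDual 𝕜 C(K, 𝕜)) : WeakDual 𝕜 C(K, 𝕜) :=
  StrongDual.toWeakDual ((WeakDual.toStrongDual μ).comp (ContinuousLinearMap.mul 𝕜 C(K, 𝕜) a))

theorem mulDual_apply (a h : C(K, 𝕜)) (μ : WeakDual 𝕜 C(K, 𝕜)) : mulDual a μ h = μ (a * h) := rfl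

theorem isOpen_lt_norm_apply {X : Type u} [NormedAddCommGroup X] [NormedSpace 𝕜 X] (r : ℝ)
    (f : X) : IsOpen {ν : WeakDual 𝕜 X | r < ‖ν f‖} :=
  isOpen_lt continuous_const (WeakDual.eval_continuous f).norm

theorem weakBall_eq_empty {X : Type u} [NormedAddCommGroup X] [NormedSpace 𝕜 X] {r : ℝ}
    (hr : r < 0) : weakBall 𝕜 X r = ∅ :=
  eq_empty_of_forall_notMem fun x hx =>
    absurd ((norm_nonneg (WeakDual.toStrongDual x)).trans hx) hr.not_ge

variable [T2Space K] {F : Set K} {R δ κ r : ℝ} {θ : Ordinal.{u}}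

/-- Functionals of norm at most `r` having more than `r - κ` of their norm on `C_F(K)` near a
given one are, up to `κ`, of the form `g ν` for a fixed cutoff function `g` with closed support
`W` disjoint from `F`.  Since `ν ↦ g ν` is weak-star continuous and takes values in the dual of
`C(W)`, such a slice disappears as quickly as the ball of `C(W)^*`. -/
theorem szlenkDeriv_weakBall_subset_vanishingBound (hδ : 0 ≤ δ) (hκ : 0 ≤ κ)
    (hW : ∀ W : Set K, IsClosed W → Disjoint W F → ∀ [CompactSpace W],
      szlenkDeriv δ (weakBall 𝕜 C(W, 𝕜) r) θ = ∅) :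
    szlenkDeriv (2 * δ + 2 * κ) (weakBall 𝕜 C(K, 𝕜) r) θ ⊆ vanishingBound F (r - κ) := by
  rcases lt_or_ge r 0 with hr | hr
  · rw [weakBall_eq_empty hr]
    exact (szlenkDeriv_subset θ).trans (empty_subset _)
  intro μ hμ f hf hf1
  by_contra! hlt
  obtain ⟨f', g, W, hWc, hWF, hf', hf'g, hg1, hgW⟩ := exists_cutoff μ hf hf1 hlt
  have : CompactSpace W := isCompact_iff_compactSpace.1 hWc.isCompact
  have hg0 (x : K) : 0 ≤ g x := (norm_nonneg _).trans (hf'g x)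
  let a : C(K, 𝕜) := ⟨fun x => (g x : 𝕜), by fun_prop⟩
  have ha (x : K) : a x = (g x : 𝕜) := rfl
  let V : Set (WeakDual 𝕜 C(K, 𝕜)) := {ν | r - κ < ‖ν f'‖}
  have hsmall {ν : WeakDual 𝕜 C(K, 𝕜)} (hν : ν ∈ weakBall 𝕜 C(K, 𝕜) r ∩ V) (h : C(K, 𝕜)) :
      ‖ν ((1 - a) * h)‖ ≤ κ * ‖h‖ := by
    rw [← vanishingBound_empty hr] at hν
    refine norm_apply_le_of_mem_vanishingBound (F := ∅) (μ := mulDual (1 - a) ν) ?_ (by simp)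
    intro h _ hh
    have h1 := norm_apply_add_norm_apply_le hν.1 (u := f') (v := (1 - a) * h) (by simp) (by simp)
      (fun x => by
        have h2 : ‖((1 - a) * h) x‖ ≤ 1 - g x := by
          have h3 : ((1 - a) * h) x = ((1 - g x : ℝ) : 𝕜) * h x := by simp [ha]
          have h4 : 0 ≤ 1 - g x := sub_nonneg.2 (hg1 x)
          rw [h3, norm_mul, RCLike.norm_ofReal, abs_of_nonneg h4]
          exact mul_le_of_le_one_right h4 ((h.norm_coe_le_norm x).trans hh)
        linarith [hf'g x])
    have h2 : r - κ < ‖ν f'‖ := hν.2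
    rw [mulDual_apply]
    linarith
  have hsub := szlenkDeriv_subset_of_rel (L := weakBall 𝕜 C(K, 𝕜) r ∩ V)
    (M := weakBall 𝕜 C(W, 𝕜) r) hδ (κ := 2 * κ) (by positivity) (isCompact_weakBall r)
    (fun ν l => ∀ h : C(K, 𝕜), ν (a * h) = l (h.restrict W))
    (by
      simp only [ofPred_forall]
      exact isClosed_iInter fun h => isClosed_eq
        ((WeakDual.eval_continuous _).comp continuous_fst)
        ((WeakDual.eval_continuous _).comp continuous_snd))
    (fun ν hν => by
      have hball : mulDual a ν ∈ weakBall 𝕜 C(K, 𝕜) r := by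
        have h0 : ‖WeakDual.toStrongDual ν‖ ≤ r := hν.1
        refine ContinuousLinearMap.opNorm_le_bound _ hr fun h => ?_
        change ‖WeakDual.toStrongDual ν (a * h)‖ ≤ r * ‖h‖
        refine ((WeakDual.toStrongDual ν).le_opNorm _).trans ?_
        gcongr
        rw [ContinuousMap.norm_le _ (norm_nonneg _)]
        intro x
        rw [ContinuousMap.mul_apply, ha, norm_mul, RCLike.norm_ofReal, abs_of_nonneg (hg0 x)]
        exact (mul_le_of_le_one_left (norm_nonneg _) (hg1 x)).trans (h.norm_coe_le_norm x)
      obtain ⟨l, hl, hl'⟩ := exists_functional_on_closed hWc le_rfl hball fun h hh => by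
        have : a * h = 0 := by
          ext x
          by_cases hx : x ∈ W
          · simp [hh x hx]
          · simp [ha, hgW x hx]
        rw [mulDual_apply, this]
        simp
      rw [add_zero] at hl
      refine ⟨l, hl, fun h => ?_⟩
      have := hl' h
      rw [zero_mul, norm_le_zero_iff, sub_eq_zero, mulDual_apply] at this
      exact this)
    (by
      intro x _ x' hx' x'' hx'' y₁ y₂ y' y'' h₁ h₂ h' h''
      refine ContinuousLinearMap.opNorm_le_bound _ (by positivity) fun h => ?_
      have e : (WeakDual.toStrongDual x' - WeakDual.toStrongDual x'') h =
          -(WeakDual.toStrongDual y₁ - WeakDual.toStrongDual y') (h.restrict W) +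
          (WeakDual.toStrongDual y₂ - WeakDual.toStrongDual y'') (h.restrict W) +
          (x' ((1 - a) * h) - x'' ((1 - a) * h)) := by
        have e1 (z : WeakDual 𝕜 C(K, 𝕜)) : z ((1 - a) * h) = z h - z (a * h) := by
          rw [← map_sub]
          congr 1
          ring
        rw [e1, e1, h', h'']
        change x' h - x'' h = -(y₁ (h.restrict W) - y' (h.restrict W)) +
          (y₂ (h.restrict W) - y'' (h.restrict W)) + _
        rw [← h₁, ← h₂]
        ring
      have hr : ‖h.restrict W‖ ≤ ‖h‖ := (ContinuousMap.norm_le _ (norm_nonneg _)).2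
        fun x => h.norm_coe_le_norm x
      rw [e]
      refine (norm_add_le _ _).trans ?_
      have t1 := norm_add_le (-(WeakDual.toStrongDual y₁ - WeakDual.toStrongDual y') (h.restrict W))
        ((WeakDual.toStrongDual y₂ - WeakDual.toStrongDual y'') (h.restrict W))
      rw [norm_neg] at t1
      have t2 := ((WeakDual.toStrongDual y₁ - WeakDual.toStrongDual y').le_opNorm _).trans
        (mul_le_mul_of_nonneg_left hr (norm_nonneg _))
      have t3 := ((WeakDual.toStrongDual y₂ - WeakDual.toStrongDual y'').le_opNorm _).trans
        (mul_le_mul_of_nonneg_left hr (norm_nonneg _))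
      have t4 := norm_sub_le (x' ((1 - a) * h)) (x'' ((1 - a) * h))
      have t5 := hsmall hx' h
      have t6 := hsmall hx'' h
      linarith) θ
  obtain ⟨l, hl, -⟩ := hsub (szlenkDeriv_inter_subset (isOpen_lt_norm_apply _ f') θ ⟨hμ, hf'⟩)
  rw [hW W hWc hWF] at hl
  exact hl

/-- Let `L` consist of the functionals of norm at most `R` having norm at most `r` on `C_F(K)`.
The members of `L` having norm more than `r - κ` on `C_F(K)` are, near a given one, `κ`-close to
functionals carried by `W ∪ F` for some fixed closed set `W` disjoint from `F`: what they have on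
`C_F(K)` is used up, except for `κ`, by a function supported in `W`. -/
theorem szlenkDeriv_weakBall_inter_vanishingBound_subset (hF : IsClosed F) (hδ : 0 ≤ δ)
    (hκ : 0 ≤ κ)
    (hW : ∀ W : Set K, IsClosed W → Disjoint W F → ∀ [CompactSpace (W ∪ F : Set K)],
      szlenkDeriv δ (weakBall 𝕜 C((W ∪ F : Set K), 𝕜) (R + κ)) θ = ∅) :
    szlenkDeriv (2 * δ + 4 * κ) (weakBall 𝕜 C(K, 𝕜) R ∩ vanishingBound F r) θ ⊆
      weakBall 𝕜 C(K, 𝕜) R ∩ vanishingBound F (r - κ) := by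
  refine fun μ hμ => ⟨(szlenkDeriv_subset θ hμ).1, fun f hf hf1 => ?_⟩
  by_contra! hlt
  obtain ⟨f', g, W, hWc, hWF, hf', hf'g, hg1, hgW⟩ := exists_cutoff μ hf hf1 hlt
  have hHc : IsClosed (W ∪ F) := hWc.union hF
  have : CompactSpace (W ∪ F : Set K) := isCompact_iff_compactSpace.1 hHc.isCompact
  have hf'W (x : K) (hx : x ∉ W) : f' x = 0 :=
    norm_le_zero_iff.1 ((hf'g x).trans_eq (hgW x hx))
  let V : Set (WeakDual 𝕜 C(K, 𝕜)) := {ν | r - κ < ‖ν f'‖}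
  have hsmall {ν : WeakDual 𝕜 C(K, 𝕜)} (hν : ν ∈ vanishingBound F r ∩ V) :
      ν ∈ vanishingBound (W ∪ F) κ := by
    intro h hh hh1
    have h1 := norm_apply_add_norm_apply_le hν.1 (u := f') (v := h)
      (fun x hx => hf'W x (hWF.notMem_of_mem_right hx)) (fun x hx => hh x (Or.inr hx))
      (fun x => by
        by_cases hx : x ∈ W
        · rw [hh x (Or.inl hx)]
          simpa using (hf'g x).trans (hg1 x)
        · rw [hf'W x hx]
          simpa using (h.norm_coe_le_norm x).trans hh1)
    have h2 : r - κ < ‖ν f'‖ := hν.2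
    linarith
  have hsub := szlenkDeriv_subset_of_rel (L := weakBall 𝕜 C(K, 𝕜) R ∩ vanishingBound F r ∩ V)
    (M := weakBall 𝕜 C((W ∪ F : Set K), 𝕜) (R + κ)) hδ (κ := 4 * κ) (by positivity)
    (isCompact_weakBall _)
    (fun ν l => ∀ h : C(K, 𝕜), ‖ν h - l (h.restrict (W ∪ F))‖ ≤ κ * ‖h‖)
    (by
      simp only [ofPred_forall]
      exact isClosed_iInter fun h => isClosed_le
        (((WeakDual.eval_continuous _).comp continuous_fst).sub
          ((WeakDual.eval_continuous _).comp continuous_snd)).norm continuous_const)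
    (fun ν hν => exists_functional_on_closed hHc hκ hν.1.1 fun h hh =>
      norm_apply_le_of_mem_vanishingBound (hsmall ⟨hν.1.2, hν.2⟩) hh)
    (by
      intro x _ x' _ x'' _ y₁ y₂ y' y'' h₁ h₂ h' h''
      refine ContinuousLinearMap.opNorm_le_bound _ (by positivity) fun h => ?_
      set p := h.restrict (W ∪ F) with hp
      have hr : ‖p‖ ≤ ‖h‖ := (ContinuousMap.norm_le _ (norm_nonneg _)).2
        fun x => h.norm_coe_le_norm x
      have t2 := ((WeakDual.toStrongDual y₁ - WeakDual.toStrongDual y').le_opNorm p).trans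
        (mul_le_mul_of_nonneg_left hr (norm_nonneg _))
      have t3 := ((WeakDual.toStrongDual y₂ - WeakDual.toStrongDual y'').le_opNorm p).trans
        (mul_le_mul_of_nonneg_left hr (norm_nonneg _))
      change ‖y₁ p - y' p‖ ≤ _ at t2
      change ‖y₂ p - y'' p‖ ≤ _ at t3
      have e : (WeakDual.toStrongDual x' - WeakDual.toStrongDual x'') h =
          (x' h - y' p) - (y₁ p - y' p) - (x h - y₁ p) + (x h - y₂ p) + (y₂ p - y'' p) -
            (x'' h - y'' p) := by
        change x' h - x'' h = _
        ring
      rw [e]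
      have s1 := norm_sub_le (x' h - y' p) (y₁ p - y' p)
      have s2 := norm_sub_le ((x' h - y' p) - (y₁ p - y' p)) (x h - y₁ p)
      have s3 := norm_add_le ((x' h - y' p) - (y₁ p - y' p) - (x h - y₁ p)) (x h - y₂ p)
      have s4 := norm_add_le ((x' h - y' p) - (y₁ p - y' p) - (x h - y₁ p) + (x h - y₂ p))
        (y₂ p - y'' p)
      have s5 := norm_sub_le ((x' h - y' p) - (y₁ p - y' p) - (x h - y₁ p) + (x h - y₂ p) +
        (y₂ p - y'' p)) (x'' h - y'' p)
      have := h₁ h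
      have := h₂ h
      have := h' h
      have := h'' h
      linarith) θ
  obtain ⟨l, hl, -⟩ := hsub (szlenkDeriv_inter_subset (isOpen_lt_norm_apply _ f') θ ⟨hμ, hf'⟩)
  rw [hW W hWc hWF] at hl
  exact hl

end Slices

/-! ### Adjoints of inclusions -/

section Adjoint

open Set Topology

variable {𝕜 : Type} [RCLike 𝕜]
variable {X : Type u} [NormedAddCommGroup X] [NormedSpace 𝕜 X]

theorem weakBall_mono {r s : ℝ} (h : r ≤ s) : weakBall 𝕜 X r ⊆ weakBall 𝕜 X s := fun x hx => by
  have h' : ‖WeakDual.toStrongDual x‖ ≤ r := hx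
  exact h'.trans h

theorem szlenkDeriv_adjointMap_image_subset {Y : Type u} [NormedAddCommGroup Y]
    [NormedSpace 𝕜 Y] {Φ : X →L[𝕜] Y} (hΦ : ‖Φ‖ ≤ 1) {M : Set (WeakDual 𝕜 Y)}
    (hM : IsCompact M) {δ : ℝ} (hδ : 0 ≤ δ) (η : Ordinal.{u}) :
    szlenkDeriv (2 * δ) (adjointMap Φ '' M) η ⊆ adjointMap Φ '' szlenkDeriv δ M η := by
  have hsub := szlenkDeriv_subset_of_rel (L := adjointMap Φ '' M) hδ le_rfl hM
    (fun x y => ∀ f, y (Φ f) = x f)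
    (by
      simp only [ofPred_forall]
      exact isClosed_iInter fun f => isClosed_eq
        ((WeakDual.eval_continuous _).comp continuous_snd)
        ((WeakDual.eval_continuous _).comp continuous_fst))
    (by
      rintro _ ⟨y, hy, rfl⟩
      exact ⟨y, hy, fun f => rfl⟩)
    (by
      intro x _ x' _ x'' _ y₁ y₂ y' y'' h₁ h₂ h' h''
      rw [add_zero]
      refine ContinuousLinearMap.opNorm_le_bound _ (by positivity) fun f => ?_
      have hr : ‖Φ f‖ ≤ ‖f‖ := (Φ.le_opNorm f).trans
        (mul_le_of_le_one_left (norm_nonneg f) hΦ)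
      have t2 := ((WeakDual.toStrongDual y₁ - WeakDual.toStrongDual y').le_opNorm (Φ f)).trans
        (mul_le_mul_of_nonneg_left hr (norm_nonneg _))
      have t3 := ((WeakDual.toStrongDual y₂ - WeakDual.toStrongDual y'').le_opNorm (Φ f)).trans
        (mul_le_mul_of_nonneg_left hr (norm_nonneg _))
      change ‖y₁ (Φ f) - y' (Φ f)‖ ≤ _ at t2
      change ‖y₂ (Φ f) - y'' (Φ f)‖ ≤ _ at t3
      rw [h₁, h'] at t2
      rw [h₂, h''] at t3
      have e : (WeakDual.toStrongDual x' - WeakDual.toStrongDual x'') f =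
          (x f - x'' f) - (x f - x' f) := by
        change x' f - x'' f = _
        ring
      rw [e]
      have := norm_sub_le (x f - x'' f) (x f - x' f)
      linarith) η
  rw [add_zero] at hsub
  intro x hx
  obtain ⟨y, hy, hxy⟩ := hsub hx
  exact ⟨y, hy, DFunLike.ext _ _ hxy⟩

theorem adjointMap_subtypeL_image_weakBall (p : Submodule 𝕜 X) (r : ℝ) :
    adjointMap p.subtypeL '' weakBall 𝕜 X r = weakBall 𝕜 p r := by
  ext y
  constructor
  · rintro ⟨x, hx, rfl⟩
    have hx' : ‖WeakDual.toStrongDual x‖ ≤ r := hx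
    exact (((WeakDual.toStrongDual x).comp p.subtypeL).opNorm_le_bound (norm_nonneg _) fun f =>
      (WeakDual.toStrongDual x).le_opNorm f).trans hx'
  · intro hy
    obtain ⟨x, hx, hxn⟩ := exists_extension_norm_eq p (WeakDual.toStrongDual y)
    exact ⟨StrongDual.toWeakDual x, hxn.trans_le hy, DFunLike.ext _ _ hx⟩

theorem szlenkSpace_submodule_le (p : Submodule 𝕜 X) :
    szlenkSpace 𝕜 p ≤ szlenkSpace 𝕜 X := by
  refine iSup₂_le fun ε hε => (firstEmpty_mono fun η hη => ?_).trans
    (le_iSup₂ (f := fun (ε : ℝ) (_ : 0 < ε) => firstEmpty (szlenkDeriv ε (dualBall 𝕜 X)))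
      (ε / 2) (half_pos hε))
  have := szlenkDeriv_adjointMap_image_subset p.norm_subtypeL_le (isCompact_weakBall (𝕜 := 𝕜) 1)
    (half_pos hε).le η
  rw [adjointMap_subtypeL_image_weakBall, mul_div_cancel₀ ε two_ne_zero] at this
  refine subset_eq_empty this ?_
  change adjointMap p.subtypeL '' szlenkDeriv (ε / 2) (dualBall 𝕜 X) η = ∅
  rw [hη, image_empty]

variable {K : Type u} [TopologicalSpace K] [CompactSpace K]

theorem weakBall_subset_vanishingBound (F : Set K) (r : ℝ) :
    weakBall 𝕜 C(K, 𝕜) r ⊆ vanishingBound F r := by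
  intro μ hμ f _ hf
  have h' : ‖WeakDual.toStrongDual μ‖ ≤ r := hμ
  exact ((WeakDual.toStrongDual μ).unit_le_opNorm f hf).trans h'

theorem vanishingBound_eq_empty (F : Set K) {r : ℝ} (hr : r < 0) :
    vanishingBound F r = (∅ : Set (WeakDual 𝕜 C(K, 𝕜))) :=
  eq_empty_of_forall_notMem fun μ hμ =>
    absurd ((norm_nonneg _).trans (hμ 0 (by simp) (by simp))) hr.not_ge

theorem adjointMap_mem_weakBall {F : Set K} {r : ℝ} {μ : WeakDual 𝕜 C(K, 𝕜)}
    (hμ : μ ∈ vanishingBound F r) :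
    adjointMap (vanishingOn 𝕜 F).subtypeL μ ∈ weakBall 𝕜 (vanishingOn 𝕜 F) r := by
  have hr : 0 ≤ r := by
    by_contra! hr
    rw [vanishingBound_eq_empty F hr] at hμ
    exact hμ
  exact ContinuousLinearMap.opNorm_le_bound _ hr fun f =>
    norm_apply_le_of_mem_vanishingBound hμ f.2

end Adjoint

/-! ### Disappearance of the derived sets of balls of `C(K)^*` -/

section Vanishing

open Set Topology

variable {𝕜 : Type} [RCLike 𝕜]

theorem szlenkDeriv_weakBall_one_eq_empty_of_finite {K : Type u} [TopologicalSpace K]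
    [CompactSpace K] [T2Space K] [Finite K] {δ : ℝ} (hδ : 0 < δ) (R : ℝ) :
    szlenkDeriv δ (weakBall 𝕜 C(K, 𝕜) R) 1 = ∅ := by
  have := Fintype.ofFinite K
  classical
  refine eq_empty_of_forall_notMem fun x hx => ?_
  rw [← zero_add (1 : Ordinal), szlenkDeriv_add_one, mem_szlenkStep_iff hδ.le] at hx
  let e (k : K) : C(K, 𝕜) := ⟨Pi.single k 1, continuous_of_discreteTopology⟩
  have hsum (f : C(K, 𝕜)) : f = ∑ k, f k • e k := by
    ext k
    simp [e, Pi.single_apply]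
  have hcont : Continuous fun y : WeakDual 𝕜 C(K, 𝕜) => ∑ k, ‖y (e k) - x (e k)‖ :=
    continuous_finsetSum _ fun k _ =>
      ((WeakDual.eval_continuous (e k)).sub continuous_const).norm
  obtain ⟨y, ⟨hy, -⟩, z, ⟨hz, -⟩, hyz⟩ := hx.2 {y | ∑ k, ‖y (e k) - x (e k)‖ < δ / 2}
    ((isOpen_lt hcont continuous_const).mem_nhds (by simpa using hδ))
  refine hyz.not_ge (ContinuousLinearMap.opNorm_le_bound _ hδ.le fun f => ?_)
  have h1 : (WeakDual.toStrongDual y - WeakDual.toStrongDual z) f =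
      ∑ k, f k * (y (e k) - z (e k)) := by
    change y f - z f = _
    conv_lhs => rw [hsum f]
    simp [map_sum, mul_sub]
  have h2 (k : K) : ‖f k * (y (e k) - z (e k))‖ ≤
      (‖y (e k) - x (e k)‖ + ‖z (e k) - x (e k)‖) * ‖f‖ := by
    rw [norm_mul, mul_comm]
    gcongr
    · rw [← sub_sub_sub_cancel_right _ _ (x (e k))]
      exact norm_sub_le _ _
    · exact f.norm_coe_le_norm k
  rw [h1]
  refine (norm_sum_le_of_le _ fun k _ => h2 k).trans ?_
  rw [← Finset.sum_mul, Finset.sum_add_distrib]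
  have hy' : ∑ k, ‖y (e k) - x (e k)‖ < δ / 2 := hy
  have hz' : ∑ k, ‖z (e k) - x (e k)‖ < δ / 2 := hz
  gcongr
  linarith

/-- From the spaces with `K^(ω^ξ) = ∅` to those with `K^(ω^ξ * (n + 1)) = ∅`.  For the inductive
step let `F = K^(ω^ξ)`.  A fixed number of blocks of `ω^ξ` derivations lowers by `κ` the norm that
the remaining functionals have on `C_F(K)`, and finitely many repetitions leave nothing.  That the
number `m` does not depend on `K` is used since the space `W ∪ F` varies with the point of the
ball. -/
theorem exists_nat_szlenkDeriv_weakBall_eq_empty {ξ : Ordinal.{u}}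
    (hξ : ∀ (R δ : ℝ), 0 < δ → ∀ (K : Type u) [TopologicalSpace K] [CompactSpace K] [T2Space K],
      cbDeriv K (ω ^ ξ) = ∅ → szlenkDeriv δ (weakBall 𝕜 C(K, 𝕜) R) (ω ^ ξ) = ∅)
    (n : ℕ) (R δ : ℝ) (hδ : 0 < δ) :
    ∃ m : ℕ, ∀ (K : Type u) [TopologicalSpace K] [CompactSpace K] [T2Space K],
      cbDeriv K (ω ^ ξ * (n + 1 : ℕ)) = ∅ →
        szlenkDeriv δ (weakBall 𝕜 C(K, 𝕜) R) (ω ^ ξ * m) = ∅ := by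
  induction n generalizing R δ with
  | zero =>
    refine ⟨1, fun K _ _ _ hK => ?_⟩
    simpa using hξ R δ hδ K (by simpa using hK)
  | succ n ih =>
    obtain ⟨m, hm⟩ := ih (R + δ / 8) (δ / 4) (by positivity)
    obtain ⟨N, hN⟩ := exists_nat_gt (R / (δ / 8))
    rw [div_lt_iff₀ (by positivity)] at hN
    refine ⟨m * N, fun K _ _ _ hK => ?_⟩
    have hstep (r : ℝ) := szlenkDeriv_weakBall_inter_vanishingBound_subset (𝕜 := 𝕜) (R := R)
      (r := r) (κ := δ / 8) (δ := δ / 4) (θ := ω ^ ξ * m) (isClosed_cbDeriv (K := K) (ω ^ ξ))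
      (by positivity) (by positivity) (fun W hW hWd _ => by
        refine hm _ (cbDeriv_union_eq_empty hW hWd ?_ ?_)
        · exact le_mul_of_one_le_right' (by simp)
        · rw [← mul_one_add]
          convert hK using 2
          rw [← Nat.cast_one, ← Nat.cast_add, add_comm])
    have hδ8 : 2 * (δ / 4) + 4 * (δ / 8) = δ := by ring
    rw [hδ8] at hstep
    have := szlenkDeriv_mul_natCast_subset
      (fun r => weakBall 𝕜 C(K, 𝕜) R ∩ vanishingBound (cbDeriv K (ω ^ ξ)) r) hstep R N
    simp only [inter_eq_left.2 (weakBall_subset_vanishingBound _ _),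
      vanishingBound_eq_empty _ (sub_neg.2 hN), inter_empty, subset_empty_iff] at this
    rwa [Ordinal.natCast_mul, ← mul_assoc]

/-- If `K^(ω^ξ)` is empty, then `ω^ξ` derivations of any size `δ` exhaust every ball of
`C(K)^*`. -/
theorem szlenkDeriv_weakBall_eq_empty (ξ : Ordinal.{u}) (R δ : ℝ) (hδ : 0 < δ) (K : Type u)
    [TopologicalSpace K] [CompactSpace K] [T2Space K] (hK : cbDeriv K (ω ^ ξ) = ∅) :
    szlenkDeriv δ (weakBall 𝕜 C(K, 𝕜) R) (ω ^ ξ) = ∅ := by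
  induction ξ using WellFoundedLT.induction generalizing R δ K with
  | ind ξ ih =>
  rcases eq_or_ne ξ 0 with rfl | hξ
  · rw [Ordinal.opow_zero] at hK ⊢
    have := finite_of_cbDeriv_one_eq_empty hK
    exact szlenkDeriv_weakBall_one_eq_empty_of_finite hδ R
  · obtain ⟨γ, hγ, hKγ⟩ := exists_cbDeriv_eq_empty_of_limit
      (Ordinal.isSuccLimit_opow_left Ordinal.isSuccLimit_omega0 hξ) hK
    obtain ⟨ζ, hζ, n, hn⟩ := (Ordinal.lt_omega0_opow hξ).1 hγ
    obtain ⟨m, hm⟩ := exists_nat_szlenkDeriv_weakBall_eq_empty (𝕜 := 𝕜) (ih ζ hζ) n R δ hδ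
    have hγn : γ ≤ ω ^ ζ * (n + 1 : ℕ) := hn.le.trans (by gcongr; exact n.le_succ)
    exact subset_eq_empty (szlenkDeriv_antitone _ _
      (Ordinal.opow_mul_lt_opow (Ordinal.natCast_lt_omega0 m) hζ).le)
      (hm K (subset_eq_empty (cbDeriv_antitone hγn) hKγ))

variable {K : Type u} [TopologicalSpace K] [CompactSpace K] [T2Space K]

theorem szlenkOp_inclDeriv_le (ξ γ : Ordinal.{u}) (hγ : γ < ω ^ ξ) :
    szlenkOp (inclDeriv 𝕜 K γ) ≤ ((ω ^ ξ : Ordinal.{u}) : WithTop Ordinal.{u}) := by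
  set F := cbDeriv K γ with hF
  refine iSup₂_le fun ε hε => firstEmpty_le ?_
  change szlenkDeriv ε (adjointMap (vanishingOn 𝕜 F).subtypeL '' weakBall 𝕜 C(K, 𝕜) 1) _ = ∅
  rw [adjointMap_subtypeL_image_weakBall]
  rcases eq_or_ne ξ 0 with rfl | hξ
  · rw [Ordinal.opow_zero] at hγ ⊢
    rw [Order.lt_one_iff.1 hγ, cbDeriv_zero] at hF
    have hzero (f : vanishingOn 𝕜 F) : f = 0 := by
      ext x
      exact f.2 x (by rw [hF]; trivial)
    refine eq_empty_of_forall_notMem fun x hx => ?_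
    rw [← zero_add (1 : Ordinal), szlenkDeriv_add_one, mem_szlenkStep_iff hε.le] at hx
    obtain ⟨y, -, z, -, hyz⟩ := hx.2 univ Filter.univ_mem
    refine hyz.not_ge (ContinuousLinearMap.opNorm_le_bound _ hε.le fun f => ?_)
    rw [hzero f]
    simp
  · obtain ⟨ζ, hζ, n, hn⟩ := (Ordinal.lt_omega0_opow hξ).1 hγ
    obtain ⟨m, hm⟩ := exists_nat_szlenkDeriv_weakBall_eq_empty (𝕜 := 𝕜)
      (szlenkDeriv_weakBall_eq_empty ζ) n 1 (ε / 8) (by positivity)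
    have hγn : γ ≤ ω ^ ζ * (n + 1 : ℕ) := hn.le.trans (by gcongr; exact n.le_succ)
    have hstep {r : ℝ} (hr : r ≤ 1) : szlenkDeriv ε (weakBall 𝕜 (vanishingOn 𝕜 F) r)
        (ω ^ ζ * m) ⊆ weakBall 𝕜 (vanishingOn 𝕜 F) (r - ε / 8) := by
      have h1 := szlenkDeriv_weakBall_subset_vanishingBound (𝕜 := 𝕜) (F := F) (r := r)
        (κ := ε / 8) (δ := ε / 8) (θ := ω ^ ζ * m) (by positivity) (by positivity)
        (fun W hW hWF _ => subset_eq_empty (szlenkDeriv_mono (weakBall_mono hr) _) (hm W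
          (subset_eq_empty (cbDeriv_antitone hγn) (cbDeriv_eq_empty_of_disjoint hWF))))
      have h2 := szlenkDeriv_adjointMap_image_subset (vanishingOn 𝕜 F).norm_subtypeL_le
        (isCompact_weakBall (𝕜 := 𝕜) r) (δ := 2 * (ε / 8) + 2 * (ε / 8)) (by positivity)
        (ω ^ ζ * m)
      have hε8 : 2 * (2 * (ε / 8) + 2 * (ε / 8)) = ε := by ring
      rw [adjointMap_subtypeL_image_weakBall, hε8] at h2
      refine h2.trans ?_
      rintro _ ⟨μ, hμ, rfl⟩
      exact adjointMap_mem_weakBall (h1 hμ)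
    obtain ⟨N, hN⟩ := exists_nat_gt (1 / (ε / 8))
    rw [div_lt_iff₀ (by positivity)] at hN
    have h := szlenkDeriv_mul_natCast_subset (ε := ε) (κ := ε / 8) (θ := ω ^ ζ * m)
      (fun r => weakBall 𝕜 (vanishingOn 𝕜 F) (min r 1))
      (fun r => (hstep (min_le_right r 1)).trans (weakBall_mono (le_min
        (by gcongr; exact min_le_left r 1) (by linarith [min_le_right r 1])))) 1 N
    simp only [min_self] at h
    rw [weakBall_eq_empty (min_lt_of_left_lt (sub_neg.2 hN)), mul_assoc, ← Ordinal.natCast_mul] at h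
    exact subset_eq_empty (szlenkDeriv_antitone _ _
      (Ordinal.opow_mul_lt_opow (Ordinal.natCast_lt_omega0 _) hζ).le) (subset_empty_iff.1 h)

theorem szlenkDeriv_dualBall_subset_vanishingBound (ξ : Ordinal.{u}) {ε : ℝ} (hε : 0 < ε) :
    szlenkDeriv (3 * ε) (dualBall 𝕜 C(K, 𝕜)) (ω ^ ξ) ⊆
      vanishingBound (cbDeriv K (ω ^ ξ)) (1 - ε) := by
  have h := szlenkDeriv_weakBall_subset_vanishingBound (𝕜 := 𝕜) (F := cbDeriv K (ω ^ ξ)) (r := 1)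
    (κ := ε) (δ := ε / 2) (θ := ω ^ ξ) (by positivity) hε.le
    (fun W hW hWF _ => szlenkDeriv_weakBall_eq_empty ξ 1 _ (half_pos hε) W
      (cbDeriv_eq_empty_of_disjoint hWF))
  have h3 : 2 * (ε / 2) + 2 * ε = 3 * ε := by ring
  rwa [h3] at h

end Vanishing

/-! ### Discrete functionals -/

section EllOne

open Set Topology

variable {𝕜 : Type} [RCLike 𝕜]

theorem hasSum_norm_ellOne {K : Type u} (a : lp (fun _ : K => 𝕜) 1) : HasSum (fun x => ‖a x‖) ‖a‖ := by
  simpa using lp.hasSum_norm (p := 1) (by simp) a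

variable {K : Type u} [TopologicalSpace K] [CompactSpace K]

theorem ellOneBall_subset_dualBall : ellOneBall 𝕜 K ⊆ dualBall 𝕜 C(K, 𝕜) := by
  rintro μ ⟨a, ha, hμ⟩
  refine ContinuousLinearMap.opNorm_le_bound _ zero_le_one fun f => ?_
  have h1 := (hμ f).norm_le_of_bounded ((hasSum_norm_ellOne a).mul_right ‖f‖) fun x => by
    rw [norm_mul]
    gcongr
    exact f.norm_coe_le_norm x
  exact h1.trans (by gcongr)

variable [T2Space K]

/-- Prescribed values of modulus at most one on a finite set `S` and zero on a closed set disjoint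
from `S` are taken by a function in the unit ball of `C(K)`. -/
theorem exists_norm_le_one_eqOn {G : Set K} (hG : IsClosed G) (S : Finset K)
    (hSG : ∀ x ∈ S, x ∉ G) (c : K → 𝕜) (hc : ∀ x, ‖c x‖ ≤ 1) :
    ∃ f : C(K, 𝕜), ‖f‖ ≤ 1 ∧ (∀ x ∈ S, f x = c x) ∧ ∀ x ∈ G, f x = 0 := by
  classical
  have hbump (x : K) (hx : x ∈ S) :
      ∃ u : C(K, ℝ), EqOn u 0 (G ∪ (S.erase x : Finset K)) ∧ EqOn u 1 {x} := by
    obtain ⟨u, hu0, hu1, -⟩ := exists_continuous_zero_one_of_isClosed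
      (hG.union (S.erase x).finite_toSet.isClosed) (isClosed_singleton (x := x)) (by
        rw [disjoint_singleton_right]
        rintro (h | h)
        · exact hSG x hx h
        · simp at h)
    exact ⟨u, hu0, hu1⟩
  choose! u hu0 hu1 using hbump
  let f₀ : C(K, 𝕜) := ⟨fun y => ∑ x ∈ S, c x * (u x y : 𝕜), by fun_prop⟩
  have hf₀S (y : K) (hy : y ∈ S) : f₀ y = c y := by
    change ∑ x ∈ S, c x * (u x y : 𝕜) = c y
    rw [Finset.sum_eq_single_of_mem y hy fun x hx hxy => by
      rw [hu0 x hx (Or.inr (by simp [hy, hxy.symm]))]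
      simp]
    rw [hu1 y hy rfl]
    simp
  have hf₀G (y : K) (hy : y ∈ G) : f₀ y = 0 :=
    Finset.sum_eq_zero fun x hx => by
      rw [hu0 x hx (Or.inl hy)]
      simp
  -- Only the values of `f₀` on `G ∪ S` matter; extending them afresh keeps the norm at most one.
  have hH : IsClosed (G ∪ (S : Set K)) := hG.union S.finite_toSet.isClosed
  have : CompactSpace (G ∪ (S : Set K) : Set K) := isCompact_iff_compactSpace.1 hH.isCompact
  obtain ⟨f, hf, hfr⟩ := exists_extension_of_isClosed hH (f₀.restrict (G ∪ (S : Set K)))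
  have hval (y : K) (hy : y ∈ G ∪ (S : Set K)) : f y = f₀ y :=
    congrArg (fun h => h ⟨y, hy⟩) hfr
  refine ⟨f, ?_, fun x hx => (hval x (Or.inr hx)).trans (hf₀S x hx),
    fun x hx => (hval x (Or.inl hx)).trans (hf₀G x hx)⟩
  rw [hf, ContinuousMap.norm_le _ zero_le_one]
  rintro ⟨y, hy⟩
  rcases hy with hy | hy
  · simp [hf₀G y hy]
  · simpa [hf₀S y hy] using hc y

/-- The mass of a discrete functional off the closed set `F` is the norm of its restriction to
`C_F(K)`. -/
theorem sum_norm_le_of_mem_vanishingBound {F : Set K} (hF : IsClosed F) {r : ℝ}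
    {μ : WeakDual 𝕜 C(K, 𝕜)} (hμ : μ ∈ vanishingBound F r) {a : lp (fun _ : K => 𝕜) 1}
    (ha : ∀ f : C(K, 𝕜), HasSum (fun x => a x * f x) (μ f)) (S : Finset K)
    (hS : ∀ x ∈ S, x ∉ F) : ∑ x ∈ S, ‖a x‖ ≤ r := by
  classical
  refine le_of_forall_pos_le_add fun τ hτ => ?_
  obtain ⟨T₀, hT₀⟩ := Filter.eventually_atTop.1
    ((hasSum_norm_ellOne a).eventually_const_lt (sub_lt_self ‖a‖ hτ))
  set T := T₀ ∪ S with hT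
  have hTτ : ‖a‖ - τ < ∑ x ∈ T, ‖a x‖ := hT₀ T Finset.subset_union_left
  choose c hc hca using fun x => RCLike.exists_norm_eq_mul_self (a x)
  obtain ⟨f, hf1, hfS, hfG⟩ := exists_norm_le_one_eqOn
    (hF.union (T \ S).finite_toSet.isClosed) S
    (by
      rintro x hx (h | h)
      · exact hS x hx h
      · simp [hx] at h) c (fun x => (hc x).le)
  have hsumT : HasSum (fun x => if x ∈ T then ‖a x‖ else 0) (∑ x ∈ T, ‖a x‖) := by
    have := hasSum_sum_of_ne_finset_zero (L := SummationFilter.unconditional K)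
      (f := fun x => if x ∈ T then ‖a x‖ else 0) (s := T)
      (fun x hx => by simp [hx])
    rwa [Finset.sum_congr rfl fun x hx => if_pos hx] at this
  have hsumS : HasSum (fun x => if x ∈ S then (‖a x‖ : 𝕜) else 0) (∑ x ∈ S, (‖a x‖ : 𝕜)) := by
    have := hasSum_sum_of_ne_finset_zero (L := SummationFilter.unconditional K)
      (f := fun x => if x ∈ S then (‖a x‖ : 𝕜) else 0) (s := S) (fun x hx => by simp [hx])
    rwa [Finset.sum_congr rfl fun x hx => if_pos hx] at this
  have htail := ((ha f).sub hsumS).norm_le_of_bounded ((hasSum_norm_ellOne a).sub hsumT)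
    fun x => by
      by_cases hxS : x ∈ S
      · have hxT : x ∈ T := Finset.mem_union_right _ hxS
        simp [hxS, hxT, hfS x hxS, hca x, mul_comm]
      · by_cases hxT : x ∈ T
        · simp [hxS, hxT, hfG x (Or.inr (by simp [hxS, hxT]))]
        · simp only [hxS, hxT, if_false, sub_zero, norm_mul]
          exact mul_le_of_le_one_right (norm_nonneg _) ((f.norm_coe_le_norm x).trans hf1)
  have hμf := hμ f (fun x hx => hfG x (Or.inl hx)) hf1
  rw [← RCLike.ofReal_sum] at htail
  have h1 := norm_sub_norm_le ((∑ x ∈ S, ‖a x‖ : ℝ) : 𝕜) (μ f)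
  rw [norm_sub_rev, RCLike.norm_ofReal, abs_of_nonneg (by positivity)] at h1
  linarith

/-- A discrete functional whose restriction to `C_F(K)` has norm at most `r` agrees on `C_F(K)`
with the one obtained by dropping its mass on `F`. -/
theorem exists_ellOneBall_smul_eqOn {F : Set K} (hF : IsClosed F) {r : ℝ} (hr : 0 < r)
    {μ : WeakDual 𝕜 C(K, 𝕜)} (hμ : μ ∈ vanishingBound F r) (hμ' : μ ∈ ellOneBall 𝕜 K) :
    ∃ ν ∈ ellOneBall 𝕜 K, ∀ f : C(K, 𝕜), (∀ x ∈ F, f x = 0) → (r : 𝕜) * ν f = μ f := by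
  classical
  obtain ⟨a, -, ha⟩ := hμ'
  let b : K → 𝕜 := fun x => if x ∈ F then 0 else (r : 𝕜)⁻¹ * a x
  have hb_sum (S : Finset K) : ∑ x ∈ S, ‖b x‖ ≤ 1 := by
    have h1 (x : K) : ‖b x‖ = if x ∉ F then r⁻¹ * ‖a x‖ else 0 := by
      by_cases hx : x ∈ F <;> simp [b, hx, abs_of_pos hr]
    simp only [h1]
    rw [← Finset.sum_filter, ← Finset.mul_sum, inv_mul_le_iff₀ hr, mul_one]
    exact sum_norm_le_of_mem_vanishingBound hF hμ ha _ fun x hx => (Finset.mem_filter.1 hx).2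
  have hb_summable : Summable fun x => ‖b x‖ :=
    summable_of_sum_le (fun _ => norm_nonneg _) hb_sum
  let b' : lp (fun _ : K => 𝕜) 1 := ⟨b, memℓp_gen (by simpa using hb_summable)⟩
  have hb'1 : ‖b'‖ ≤ 1 := hasSum_le_of_sum_le (hasSum_norm_ellOne b') hb_sum
  have hbf (f : C(K, 𝕜)) : Summable fun x => b x * f x :=
    Summable.of_norm_bounded (hb_summable.mul_right ‖f‖) fun x => by
      rw [norm_mul]
      gcongr
      exact f.norm_coe_le_norm x
  let l : C(K, 𝕜) →L[𝕜] 𝕜 := LinearMap.mkContinuous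
    { toFun := fun f => ∑' x, b x * f x
      map_add' := fun f g => by
        rw [← (hbf f).tsum_add (hbf g)]
        simp [mul_add]
      map_smul' := fun c f => by
        rw [RingHom.id_apply, smul_eq_mul, ← tsum_mul_left]
        simp [mul_left_comm] } 1 (fun f => by
        refine tsum_of_norm_bounded ((hasSum_norm_ellOne b').mul_right ‖f‖) (fun x => ?_)
          |>.trans (by gcongr)
        change ‖b x * f x‖ ≤ ‖b x‖ * ‖f‖
        rw [norm_mul]
        gcongr
        exact f.norm_coe_le_norm x)
  refine ⟨StrongDual.toWeakDual l, ⟨b', hb'1, fun f => (hbf f).hasSum⟩, fun f hf => ?_⟩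
  have heq : (fun x => (r : 𝕜) * (b x * f x)) = fun x => a x * f x := funext fun x => by
    by_cases hx : x ∈ F
    · simp [hf x hx]
    · have hr' : (r : 𝕜) ≠ 0 := RCLike.ofReal_ne_zero.2 hr.ne'
      simp [b, hx, hr', ← mul_assoc]
  have hsum : HasSum (fun x => (r : 𝕜) * (b x * f x)) (μ f) := heq ▸ ha f
  exact ((hbf f).hasSum.mul_left (r : 𝕜)).unique hsum

end EllOne

end

theorem theorem3p1 (𝕜 : Type) [RCLike 𝕜] (ξ : Ordinal.{u}) :
    -- (A)
    (∀ (K : Type u) [TopologicalSpace K] [CompactSpace K] [T2Space K],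
      cbIndex K ≤ ((ω ^ ξ : Ordinal.{u}) : WithTop Ordinal.{u}) →
        szlenkSpace 𝕜 (czero 𝕜 K) ≤ szlenkSpace 𝕜 C(K, 𝕜) ∧
        szlenkSpace 𝕜 C(K, 𝕜) ≤ ((ω ^ ξ : Ordinal.{u}) : WithTop Ordinal.{u})) ∧
    -- (B)
    (∀ γ : Ordinal.{u}, γ < ω ^ ξ →
      ∀ (K : Type u) [TopologicalSpace K] [CompactSpace K] [T2Space K],
        (γ : WithTop Ordinal.{u}) < cbIndex K →
          szlenkOp (inclDeriv 𝕜 K γ) ≤ ((ω ^ ξ : Ordinal.{u}) : WithTop Ordinal.{u})) ∧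
    -- (C)
    (∀ (K : Type u) [TopologicalSpace K] [CompactSpace K] [T2Space K],
      ((ω ^ ξ : Ordinal.{u}) : WithTop Ordinal.{u}) < cbIndex K →
        ∀ ε : ℝ, 0 < ε → ε < 1 →
          adjointMap (inclDeriv 𝕜 K (ω ^ ξ)) ''
              szlenkDeriv (3 * ε) (ellOneBall 𝕜 K) (ω ^ ξ) ⊆
            ((1 - ε : ℝ) : 𝕜) • (adjointMap (inclDeriv 𝕜 K (ω ^ ξ)) '' ellOneBall 𝕜 K) ∧
          adjointMap (inclDeriv 𝕜 K (ω ^ ξ)) ''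
              szlenkDeriv (3 * ε) (dualBall 𝕜 C(K, 𝕜)) (ω ^ ξ) ⊆
            ((1 - ε : ℝ) : 𝕜) •
              (adjointMap (inclDeriv 𝕜 K (ω ^ ξ)) '' dualBall 𝕜 C(K, 𝕜))) := by
  refine ⟨fun K _ _ _ hK => ⟨szlenkSpace_submodule_le _, ?_⟩,
    fun γ hγ K _ _ _ _ => szlenkOp_inclDeriv_le ξ γ hγ, fun K _ _ _ _ ε hε hε1 => ⟨?_, ?_⟩⟩
  · exact iSup₂_le fun ε hε => firstEmpty_le (szlenkDeriv_weakBall_eq_empty ξ 1 ε hε K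
      (eq_empty_of_firstEmpty_le cbDeriv_antitone hK))
  · rintro _ ⟨μ, hμ, rfl⟩
    obtain ⟨ν, hν, h⟩ := exists_ellOneBall_smul_eqOn (isClosed_cbDeriv (ω ^ ξ)) (sub_pos.2 hε1)
      (szlenkDeriv_dualBall_subset_vanishingBound ξ hε
        (szlenkDeriv_mono ellOneBall_subset_dualBall _ hμ)) (szlenkDeriv_subset _ hμ)
    exact ⟨_, ⟨ν, hν, rfl⟩, DFunLike.ext _ _
      fun f : vanishingOn 𝕜 (cbDeriv K (ω ^ ξ)) => h f f.2⟩
  · rintro _ ⟨μ, hμ, rfl⟩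
    have hr : 0 < 1 - ε := sub_pos.2 hε1
    have hr' : ((1 - ε : ℝ) : 𝕜) ≠ 0 := RCLike.ofReal_ne_zero.2 hr.ne'
    have h1 := adjointMap_mem_weakBall (szlenkDeriv_dualBall_subset_vanishingBound ξ hε hμ)
    rw [← adjointMap_subtypeL_image_weakBall] at h1
    obtain ⟨ν, hν, hνμ⟩ := h1
    refine ⟨_, ⟨((1 - ε : ℝ) : 𝕜)⁻¹ • ν, ?_, rfl⟩, DFunLike.ext _ _ fun f => ?_⟩
    · change ‖((1 - ε : ℝ) : 𝕜)⁻¹ • WeakDual.toStrongDual ν‖ ≤ 1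
      have hν' : ‖WeakDual.toStrongDual ν‖ ≤ 1 - ε := hν
      rw [norm_smul, norm_inv, RCLike.norm_ofReal, abs_of_pos hr, inv_mul_le_iff₀ hr, mul_one]
      exact hν'
    · have h2 : ν (f : C(K, 𝕜)) = μ (f : C(K, 𝕜)) := congrArg (fun l => l f) hνμ
      change ((1 - ε : ℝ) : 𝕜) * (((1 - ε : ℝ) : 𝕜)⁻¹ * ν (f : C(K, 𝕜))) = μ (f : C(K, 𝕜))
      rw [h2, mul_inv_cancel_left₀ hr']
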